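/- **Setting.** The $\lambda_c$-terms are $t,u ::= x \mid t\,u \mid \lambda x.\,t \mid \mathsf{cc} \mid k_\pi \mid a_n \mid b_n$ ($n\in\mathbb N$; $a_n$ are the nonrestricted and $b_n$ the restricted instructions), the stacks are $\pi ::= \omega_n \mid t\cdot\pi$ ($t$ closed), and processes are pairs $t\star\pi$ with $t$ closed, everything modulo $\alpha$-equivalence. Evaluation $\succ$ is the smallest preorder on processes with $tu\star\pi\succ t\star u\cdot\pi$, $\ \lambda x.t\star u\cdot\pi\succ t[x:=u]\star\pi$, $\ \mathsf{cc}\star t\cdot\pi\succ t\star k_\pi\cdot\pi$, $\ k_{\pi'}\star t\cdot\pi\succ t\star\pi'$. A pole $\bot\!\!\!\bot$ is a set of processes such that $p\succ q\in\bot\!\!\!\bot$ implies $p\in\bot\!\!\!\bot$. A closed term is proof-like if it contains no $k_\pi$ and no $b_n$. First-order terms are built from variables and all functions $\mathbb N^n\to\mathbb N$; formulas are built from atoms $X(a_1,\dots,a_n)$ (second-order variables), parameters $F(a_1,\dots,a_n)$ with $F:\mathbb N^n\to\mathcal P(\Pi)$ ($\Pi$ the set of stacks), $\top$, $\bot$,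 $\to$, first- and second-order $\forall$, equational implication $(a=b)\mapsto A$, $\cap$ and $\cup$. Write $|A|$ for the set of closed terms $t$ with $t\star\pi\in\bot\!\!\!\bot$ for all $\pi\in\|A\|$. The falsity values of closed formulas with respect to $\bot\!\!\!\bot$ are: $\|\top\|=\emptyset$, $\|\bot\|=\Pi$, $\|A\to B\|=\{t\cdot\pi: t\in|A|,\ \pi\in\|B\|\}$, $\|\forall x\,A\|=\bigcup_{n\in\mathbb N}\|A[x:=n]\|$, $\|\forall X\,A\|=\bigcup_{F}\|A[X:=F]\|$, $\|(a=b)\mapsto A\|=\|A\|$ if $a$ and $b$ have the same value and $\emptyset$ otherwise, $\|A\cap B\|=\|A\|\cup\|B\|$, $\|A\cup B\|=\|A\|\cap\|B\|$, and $\|F(a_1,\dots,a_n)\|$ is $F$ at the values of the $a_i$. A closed term $t$ realizes $A$ with respect to $\bot\!\!\!\bot$ if $t\in|A|$. Equality and $\wedge,\vee,\leftrightarrow$ are the usual second-order encodings: $a=b$ is $\forall Z\,(Z(a)\to Z(b))$, $A\wedge B$ is $\forall Z\,((A\to B\to Z)\to Z)$, $A\vee B$ is $\forall Z\,((A\to Z)\to(B\to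 Z)\to Z)$, and $A\leftrightarrow B$ is $(A\to B)\wedge(B\to A)$. Two closed formulas $A,B$ are *universally equivalent* if there is a single proof-like term that realizes $A\leftrightarrow B$ with respect to every pole. Let $\mathrm{nat}(x)$ be $\forall Z\,\big((\forall y\,(Z(y)\to Z(y+1)))\to Z(0)\to Z(x)\big)$, and let $\forall x^{\gimel 2}A$ be $\forall x\,\big((\min(x+1,2)=x+1)\mapsto A\big)$. For $n\ge 1$ let $|\gimel 2|<n$ be the formula $\forall x_1^{\gimel 2}\cdots\forall x_n^{\gimel 2}\ \bigvee_{i\ne j}x_i=x_j$, let $|\gimel 2|\ge n$ be $(|\gimel 2|<n)\to\bot$, and let $|\gimel 2|=n$ be $(|\gimel 2|\ge n)\wedge(|\gimel 2|<n+1)$. **Proposition.** The closed formulas $|\gimel 2|=2$ and $\forall x\,\mathrm{nat}(x)$ are universally equivalent. -/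

import Mathlib

namespace ClassicalRealizability

/-! ### The computational model: terms, stacks, evaluation -/

mutual
/-- `Tm k` is the type of `λ_c`-terms whose free variables are among `k` given ones, modulo
`α`-equivalence (well-scoped de Bruijn indices, `var 0` being the innermost variable). -/
inductive Tm : ℕ → Type
  | var {k : ℕ} (i : Fin k) : Tm k
  | app {k : ℕ} (t u : Tm k) : Tm k
  | lam {k : ℕ} (t : Tm (k + 1)) : Tm k
  /-- call-with-current-continuation -/
  | cc {k : ℕ} : Tm k
  /-- the continuation constant `k_π` -/
  | cont {k : ℕ} (π : Stack) : Tm k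
  /-- nonrestricted instructions -/
  | instrA {k : ℕ} (n : ℕ) : Tm k
  /-- restricted instructions -/
  | instrB {k : ℕ} (n : ℕ) : Tm k
/-- Stacks: finite lists of closed terms, ended by a stack bottom. -/
inductive Stack : Type
  | bottom (n : ℕ) : Stack
  | push (t : Tm 0) (π : Stack) : Stack
end

/-- Renaming of the free variables. -/
def Tm.rename {k m : ℕ} : Tm k → (Fin k → Fin m) → Tm m
  | .var i, ξ => .var (ξ i)
  | .app t u, ξ => .app (t.rename ξ) (u.rename ξ)
  | .lam t, ξ => .lam (t.rename (Fin.cases 0 fun i => (ξ i).succ))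
  | .cc, _ => .cc
  | .cont π, _ => .cont π
  | .instrA n, _ => .instrA n
  | .instrB n, _ => .instrB n

/-- Simultaneous capture-avoiding substitution. -/
def Tm.subst {k m : ℕ} : Tm k → (Fin k → Tm m) → Tm m
  | .var i, σ => σ i
  | .app t u, σ => .app (t.subst σ) (u.subst σ)
  | .lam t, σ => .lam (t.subst (Fin.cases (.var 0) fun i => (σ i).rename Fin.succ))
  | .cc, _ => .cc
  | .cont π, _ => .cont π
  | .instrA n, _ => .instrA n
  | .instrB n, _ => .instrB n

/-- A term is proof-like if it contains neither continuation constants nor restricted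
instructions. -/
def Tm.ProofLike {k : ℕ} : Tm k → Prop
  | .var _ => True
  | .app t u => t.ProofLike ∧ u.ProofLike
  | .lam t => t.ProofLike
  | .cc => True
  | .cont _ => False
  | .instrA _ => True
  | .instrB _ => False

/-- Processes `t ⋆ π`. -/
structure Proc where
  head : Tm 0
  stack : Stack

/-- One-step evaluation. -/
inductive Step : Proc → Proc → Prop
  | push (t u : Tm 0) (π : Stack) : Step ⟨.app t u, π⟩ ⟨t, .push u π⟩
  | grab (t : Tm 1) (u : Tm 0) (π : Stack) :
      Step ⟨.lam t, .push u π⟩ ⟨t.subst fun _ => u, π⟩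
  | save (t : Tm 0) (π : Stack) : Step ⟨.cc, .push t π⟩ ⟨t, .push (.cont π) π⟩
  | restore (t : Tm 0) (π π' : Stack) : Step ⟨.cont π', .push t π⟩ ⟨t, π'⟩

/-- The evaluation relation: the smallest preorder containing one-step evaluation. -/
def Evaluates : Proc → Proc → Prop := Relation.ReflTransGen Step

/-- A pole is a set of processes closed by anti-evaluation. -/
structure Pole where
  carrier : Set Proc
  anti_evaluation : ∀ p q : Proc, Evaluates p q → q ∈ carrier → p ∈ carrier

/-- The dual `X^P = {t | ∀ π ∈ X, t ⋆ π ∈ P}` of a set of stacks. -/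
def Pole.dual (P : Pole) (X : Set Stack) : Set (Tm 0) := {t | ∀ π ∈ X, Proc.mk t π ∈ P.carrier}

/-! ### The realizability language -/

/-- First-order terms with free variables among `k` given ones; every function `ℕⁿ → ℕ` is a
function symbol. -/
inductive FOTerm (k : ℕ) : Type
  | var (i : Fin k) : FOTerm k
  | app {n : ℕ} (f : (Fin n → ℕ) → ℕ) (a : Fin n → FOTerm k) : FOTerm k

/-- Value of a first-order term, the variables being replaced by the integers `ρ i`. -/
def FOTerm.val {k : ℕ} (ρ : Fin k → ℕ) : FOTerm k → ℕ
  | .var i => ρ i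
  | .app f a => f fun j => (a j).val ρ

/-- `SOVar Γ n`: the `n`-ary propositional variables of the context `Γ` (a list of arities,
innermost variable first). -/
inductive SOVar : List ℕ → ℕ → Type
  | zero {Γ : List ℕ} {n : ℕ} : SOVar (n :: Γ) n
  | succ {Γ : List ℕ} {m n : ℕ} (X : SOVar Γ n) : SOVar (m :: Γ) n

/-- `Formula Γ k`: formulas, modulo `α`-equivalence, with free propositional variables in `Γ` and
free first-order variables among `k` given ones. Closed formulas are the elements of
`Formula [] 0`. -/
inductive Formula : List ℕ → ℕ → Type
  | rel {Γ : List ℕ} {k n : ℕ} (X : SOVar Γ n) (a : Fin n → FOTerm k) : Formula Γ k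
  | top {Γ : List ℕ} {k : ℕ} : Formula Γ k
  | bot {Γ : List ℕ} {k : ℕ} : Formula Γ k
  | imp {Γ : List ℕ} {k : ℕ} (A B : Formula Γ k) : Formula Γ k
  /-- first-order quantification `∀ x, A` -/
  | all {Γ : List ℕ} {k : ℕ} (A : Formula Γ (k + 1)) : Formula Γ k
  /-- second-order quantification `∀ X, A`, where `X` is `n`-ary -/
  | all₂ {Γ : List ℕ} {k : ℕ} (n : ℕ) (A : Formula (n :: Γ) k) : Formula Γ k
  /-- equational implication `(a = b) ↦ A` -/
  | eqImp {Γ : List ℕ} {k : ℕ} (a b : FOTerm k) (A : Formula Γ k) : Formula Γ k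
  | inter {Γ : List ℕ} {k : ℕ} (A B : Formula Γ k) : Formula Γ k
  | union {Γ : List ℕ} {k : ℕ} (A B : Formula Γ k) : Formula Γ k
  /-- a parameter `F : ℕⁿ → 𝒫(stacks)` applied to first-order terms -/
  | param {Γ : List ℕ} {k n : ℕ} (F : (Fin n → ℕ) → Set Stack) (a : Fin n → FOTerm k) :
      Formula Γ k

/-- Assignment of a parameter to each propositional variable. -/
def SOEnv (Γ : List ℕ) : Type := ∀ n : ℕ, SOVar Γ n → (Fin n → ℕ) → Set Stack

/-- The empty assignment. -/
def SOEnv.nil : SOEnv [] := fun _ X => nomatch X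

/-- Extension of an assignment to a new innermost variable. -/
def SOEnv.cons {Γ : List ℕ} {m : ℕ} (F : (Fin m → ℕ) → Set Stack) (σ : SOEnv Γ) :
    SOEnv (m :: Γ)
  | _, .zero => F
  | _, .succ X => σ _ X

/-- Falsity value, with respect to the pole `P`, of the closed formula obtained from a formula by
replacing its free variables by the parameters given by `σ` and the integers given by `ρ`. -/
def Formula.falsity (P : Pole) : {Γ : List ℕ} → {k : ℕ} → Formula Γ k → SOEnv Γ → (Fin k → ℕ) →
    Set Stack
  | _, _, .rel X a, σ, ρ => σ _ X fun j => (a j).val ρ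
  | _, _, .top, _, _ => ∅
  | _, _, .bot, _, _ => Set.univ
  | _, _, .imp A B, σ, ρ =>
      {s | ∃ t ∈ P.dual (A.falsity P σ ρ), ∃ π ∈ B.falsity P σ ρ, s = .push t π}
  | _, _, .all A, σ, ρ => ⋃ m : ℕ, A.falsity P σ (Fin.cons m ρ)
  | _, _, .all₂ n A, σ, ρ => ⋃ F : (Fin n → ℕ) → Set Stack, A.falsity P (σ.cons F) ρ
  | _, _, .eqImp a b A, σ, ρ => {s | a.val ρ = b.val ρ ∧ s ∈ A.falsity P σ ρ}
  | _, _, .inter A B, σ, ρ => A.falsity P σ ρ ∪ B.falsity P σ ρ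
  | _, _, .union A B, σ, ρ => A.falsity P σ ρ ∩ B.falsity P σ ρ
  | _, _, .param F a, _, ρ => F fun j => (a j).val ρ

/-- `t` realizes the closed formula `A` with respect to the pole `P`. -/
def Realizes (P : Pole) (t : Tm 0) (A : Formula [] 0) : Prop :=
  t ∈ P.dual (A.falsity P SOEnv.nil Fin.elim0)

/-- A closed formula is universally realized if some proof-like term realizes it with respect to
every pole. -/
def UniversallyRealized (A : Formula [] 0) : Prop :=
  ∃ t : Tm 0, t.ProofLike ∧ ∀ P : Pole, Realizes P t A

/-! ### Defined connectives -/

/-- Renaming of the propositional variables. -/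
def Formula.renameSO : {Γ Δ : List ℕ} → {k : ℕ} → Formula Γ k →
    (∀ n : ℕ, SOVar Γ n → SOVar Δ n) → Formula Δ k
  | _, _, _, .rel X a, ξ => .rel (ξ _ X) a
  | _, _, _, .top, _ => .top
  | _, _, _, .bot, _ => .bot
  | _, _, _, .imp A B, ξ => .imp (A.renameSO ξ) (B.renameSO ξ)
  | _, _, _, .all A, ξ => .all (A.renameSO ξ)
  | _, _, _, .all₂ n A, ξ => .all₂ n (A.renameSO fun
      | _, .zero => .zero
      | _, .succ X => .succ (ξ _ X))
  | _, _, _, .eqImp a b A, ξ => .eqImp a b (A.renameSO ξ)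
  | _, _, _, .inter A B, ξ => .inter (A.renameSO ξ) (B.renameSO ξ)
  | _, _, _, .union A B, ξ => .union (A.renameSO ξ) (B.renameSO ξ)
  | _, _, _, .param F a, _ => .param F a

/-- Weakening: view `A` as a formula in which a new `m`-ary variable may (but does not) occur. -/
def Formula.weaken {Γ : List ℕ} {k : ℕ} (m : ℕ) (A : Formula Γ k) : Formula (m :: Γ) k :=
  A.renameSO fun _ X => .succ X

/-- `X(a)` for a unary variable `X`. -/
def Formula.rel₁ {Γ : List ℕ} {k : ℕ} (X : SOVar Γ 1) (a : FOTerm k) : Formula Γ k :=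
  .rel X ![a]

/-- `a = b` is `∀ Z, Z(a) → Z(b)`. -/
def Formula.eq {Γ : List ℕ} {k : ℕ} (a b : FOTerm k) : Formula Γ k :=
  .all₂ 1 (.imp (.rel₁ .zero a) (.rel₁ .zero b))

/-- `A ∧ B` is `∀ Z, (A → B → Z) → Z`. -/
def Formula.and {Γ : List ℕ} {k : ℕ} (A B : Formula Γ k) : Formula Γ k :=
  .all₂ 0 (.imp (.imp (A.weaken 0) (.imp (B.weaken 0) (.rel .zero ![]))) (.rel .zero ![]))

/-- `A ∨ B` is `∀ Z, (A → Z) → (B → Z) → Z`. -/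
def Formula.or {Γ : List ℕ} {k : ℕ} (A B : Formula Γ k) : Formula Γ k :=
  .all₂ 0 (.imp (.imp (A.weaken 0) (.rel .zero ![]))
    (.imp (.imp (B.weaken 0) (.rel .zero ![])) (.rel .zero ![])))

/-- `A ↔ B` is `(A → B) ∧ (B → A)`. -/
def Formula.iff {Γ : List ℕ} {k : ℕ} (A B : Formula Γ k) : Formula Γ k :=
  .and (.imp A B) (.imp B A)

/-- Left-associated finite disjunction (`⊥` if there is no disjunct). -/
def Formula.bigOr {Γ : List ℕ} {k : ℕ} : List (Formula Γ k) → Formula Γ k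
  | [] => .bot
  | A :: L => L.foldl .or A

/-- Universal closure with respect to the first-order variables. -/
def Formula.closeFO : {k : ℕ} → {Γ : List ℕ} → Formula Γ k → Formula Γ 0
  | 0, _, A => A
  | _ + 1, _, A => A.all.closeFO

/-- Universal closure with respect to the propositional variables. -/
def Formula.closeSO : {Γ : List ℕ} → Formula Γ 0 → Formula [] 0
  | [], A => A
  | n :: _, A => (Formula.all₂ n A).closeSO

/-- Two formulas in the same free variables are universally equivalent if the universal closure of
`A ↔ B` is universally realized. -/
def UniversallyEquivalent {Γ : List ℕ} {k : ℕ} (A B : Formula Γ k) : Prop :=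
  UniversallyRealized (A.iff B).closeFO.closeSO

/-! ### Natural numbers and the characteristic Boolean algebra -/

/-- The integer `n` as a first-order term. -/
def FOTerm.const {k : ℕ} (n : ℕ) : FOTerm k := .app (fun _ : Fin 0 → ℕ => n) ![]

/-- The successor `s(a) = a + 1`. -/
def FOTerm.succ {k : ℕ} (a : FOTerm k) : FOTerm k := .app (fun v : Fin 1 → ℕ => v 0 + 1) ![a]

/-- The term `min(a, b)`. -/
def FOTerm.min {k : ℕ} (a b : FOTerm k) : FOTerm k :=
  .app (fun v : Fin 2 → ℕ => Min.min (v 0) (v 1)) ![a, b]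

/-- `nat(a)` is the formula `∀ Z, (∀ y, Z(y) → Z(s(y))) → Z(0) → Z(a)`. -/
def Formula.nat {Γ : List ℕ} {k : ℕ} (a : FOTerm k) : Formula Γ k :=
  .all₂ 1 (.imp (.all (.imp (.rel₁ .zero (.var 0)) (.rel₁ .zero (.succ (.var 0)))))
    (.imp (.rel₁ .zero (.const 0)) (.rel₁ .zero a)))

/-- The relativized quantification `∀ x^{ℷn}, A`, that is `∀ x, ℷn(x) ↦ A`, where `ℷn(x)` is
`x + 1 ≤ n`, i.e. the equation `min(x + 1, n) = x + 1`. -/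
def Formula.allGimel {Γ : List ℕ} {k : ℕ} (n : ℕ) (A : Formula Γ (k + 1)) : Formula Γ k :=
  .all (.eqImp (.min (.succ (.var 0)) (.const n)) (.succ (.var 0)) A)

/-- Quantification of all the first-order variables, each one relativized to `ℷn`. -/
def Formula.closeGimel (n : ℕ) : {k : ℕ} → {Γ : List ℕ} → Formula Γ k → Formula Γ 0
  | 0, _, A => A
  | _ + 1, _, A => (A.allGimel n).closeGimel n

/-- The formula `|ℷ2| < n` (for `n` positive): `ℷ2 ⊨ ∀ x_1 … x_n, ⋁_{i ≠ j} x_i = x_j`, the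
disjunction ranging over the ordered pairs `(i, j)` with `i ≠ j`. -/
def gimelLt (n : ℕ) : Formula [] 0 :=
  Formula.closeGimel 2 (Formula.bigOr
    (((List.finRange n ×ˢ List.finRange n).filter fun p => p.1 ≠ p.2).map
      fun p => Formula.eq (.var p.1) (.var p.2)))

/-- The formula `|ℷ2| ≥ n`: `(|ℷ2| < n) → ⊥`. -/
def gimelGe (n : ℕ) : Formula [] 0 := .imp (gimelLt n) .bot

/-- The formula `|ℷ2| = n`: `(|ℷ2| ≥ n) ∧ (|ℷ2| < n + 1)`. -/
def gimelEq (n : ℕ) : Formula [] 0 := .and (gimelGe n) (gimelLt (n + 1))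

/-- The formula `∀ x, nat(x)`. -/
def allNat : Formula [] 0 := .all (.nat (.var 0))

end ClassicalRealizability

namespace ClassicalRealizability

/-! ### Substitution in closed terms -/

-- The inequality `|ℷ2| ≥ 2` is always realized, since `0 = 1` and `1 = 0` are false, so the content
-- is the equivalence of `|ℷ2| < 3` with `∀ x, nat(x)`.
--
-- From `∀ x, nat(x)`, recursion with an eventually discarded predecessor tells a Boolean `0` from a
-- Boolean `1` (`allNat_cases`). Three Booleans can then be compared, and by pigeonhole two of them
-- agree.
--
-- Conversely, a realizer of `|ℷ2| < 3` realizes every instance, in particular `(0, 0, 1)` and `(1,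
-- 0, 1)`. Handling its six disjuncts gives one term, independent of the Boolean, that lies in the
-- pole against `π` as soon as one of two chosen terms does (`boolCases_mem`). A self-application `W
-- W` that offers the choice between `z` and `s (W W)` therefore behaves as the `x`-th iterate of
-- `s` on `z` for every `x` at once. This realizes `nat(x)` uniformly in `x`, by induction on `x`.

theorem Tm.subst_var_comp {k m : ℕ} (t : Tm k) (ξ : Fin k → Fin m) (σ : Fin k → Tm m)
    (h : ∀ i, σ i = .var (ξ i)) : t.subst σ = t.rename ξ := by
  match t with
  | .var i => simp [subst, rename, h]
  | .app t u => simp [subst, rename, subst_var_comp t ξ σ h, subst_var_comp u ξ σ h]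
  | .lam t =>
    simp only [subst, rename]
    congr 1
    apply subst_var_comp
    intro i
    cases i using Fin.cases with
    | zero => rfl
    | succ i => simp [h, rename]
  | .cc | .cont _ | .instrA _ | .instrB _ => simp [subst, rename]

theorem Tm.subst_rename {k m n : ℕ} (t : Tm k) (ξ : Fin k → Fin m) (σ : Fin m → Tm n) :
    (t.rename ξ).subst σ = t.subst fun i => σ (ξ i) := by
  match t with
  | .var i => simp [subst, rename]
  | .app t u => simp [subst, rename, subst_rename t, subst_rename u]
  | .lam t =>
    simp only [subst, rename, subst_rename t]
    congr 2
    funext i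
    cases i using Fin.cases with
    | zero => rfl
    | succ i => simp
  | .cc | .cont _ | .instrA _ | .instrB _ => simp [subst, rename]

theorem Tm.rename_rename {k m n : ℕ} (t : Tm k) (ξ : Fin k → Fin m) (ζ : Fin m → Fin n) :
    (t.rename ξ).rename ζ = t.rename fun i => ζ (ξ i) := by
  match t with
  | .var i => simp [rename]
  | .app t u => simp [rename, rename_rename t, rename_rename u]
  | .lam t =>
    simp only [rename, rename_rename t]
    congr 2
    funext i
    cases i using Fin.cases with
    | zero => rfl
    | succ i => simp
  | .cc | .cont _ | .instrA _ | .instrB _ => simp [rename]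

theorem Tm.rename_id {k : ℕ} (t : Tm k) (ξ : Fin k → Fin k) (h : ∀ i, ξ i = i) :
    t.rename ξ = t := by
  match t with
  | .var i => simp [rename, h]
  | .app t u => simp [rename, rename_id t ξ h, rename_id u ξ h]
  | .lam t =>
    simp only [rename]
    congr 1
    apply rename_id
    intro i
    cases i using Fin.cases with
    | zero => rfl
    | succ i => simp [h]
  | .cc | .cont _ | .instrA _ | .instrB _ => simp [rename]

/-- A closed term, viewed as a term in `k` variables. -/
def Tm.lift {k : ℕ} (t : Tm 0) : Tm k := t.rename Fin.elim0

@[simp] theorem Tm.lift_zero (t : Tm 0) : (t.lift : Tm 0) = t :=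
  t.rename_id _ fun i => i.elim0

@[simp] theorem Tm.rename_lift {k m : ℕ} (t : Tm 0) (ξ : Fin k → Fin m) :
    (t.lift : Tm k).rename ξ = t.lift := by
  rw [lift, rename_rename]
  exact congrArg _ (funext fun i => i.elim0)

-- Closed arguments grabbed early stay intact when later arguments are substituted; every evaluation
-- of a multi-argument combinator below rests on this.
@[simp] theorem Tm.subst_lift {k m : ℕ} (t : Tm 0) (σ : Fin k → Tm m) :
    (t.lift : Tm k).subst σ = t.lift := by
  rw [lift, subst_rename]
  exact t.subst_var_comp _ _ fun i => i.elim0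

theorem Tm.rename_closed {k : ℕ} (t : Tm 0) (ξ : Fin 0 → Fin k) : t.rename ξ = t.lift :=
  congrArg _ (funext fun i => i.elim0)

/-! ### Evaluation of the combinators -/

section Pole

variable {P : Pole} {t u v : Tm 0} {π : Stack}

theorem Pole.mem_of_step {p q : Proc} (h : Step p q) (hq : q ∈ P.carrier) :
    p ∈ P.carrier :=
  P.anti_evaluation p q (.single h) hq

theorem Pole.app_mem
    (h : Proc.mk t (.push u π) ∈ P.carrier) : Proc.mk (.app t u) π ∈ P.carrier :=
  mem_of_step (.push t u π) h

theorem Pole.lam_mem {t : Tm 1}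
    (h : Proc.mk (t.subst fun _ => u) π ∈ P.carrier) :
    Proc.mk (.lam t) (.push u π) ∈ P.carrier :=
  mem_of_step (.grab t u π) h

/-- The combinator `λ x y, x`. -/
def Tm.const {k : ℕ} : Tm k := .lam (.lam (.var 1))

/-- The combinator `λ x y, y x`. -/
def Tm.flip {k : ℕ} : Tm k := .lam (.lam (.app (.var 0) (.var 1)))

/-- The combinator `λ x y z, z x y`. -/
def Tm.pair {k : ℕ} : Tm k := .lam (.lam (.lam (.app (.app (.var 0) (.var 2)) (.var 1))))

/-- The combinator `λ x, x`. -/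
def Tm.ident {k : ℕ} : Tm k := .lam (.var 0)

/-- The combinator `λ x y z, y x`. -/
def Tm.inl {k : ℕ} : Tm k := .lam (.lam (.lam (.app (.var 1) (.var 2))))

/-- The combinator `λ x y z, z x`. -/
def Tm.inr {k : ℕ} : Tm k := .lam (.lam (.lam (.app (.var 0) (.var 2))))

theorem Tm.subst_const {k m : ℕ} (σ : Fin k → Tm m) : (const : Tm k).subst σ = const := by
  simp [const, subst]; rfl

theorem Tm.subst_flip {k m : ℕ} (σ : Fin k → Tm m) : (flip : Tm k).subst σ = flip := by
  simp [flip, subst]; rfl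

theorem Tm.subst_pair {k m : ℕ} (σ : Fin k → Tm m) : (pair : Tm k).subst σ = pair := by
  simp [pair, subst]; exact ⟨rfl, rfl⟩

theorem Tm.subst_ident {k m : ℕ} (σ : Fin k → Tm m) : (ident : Tm k).subst σ = ident := by
  simp [ident, subst]

theorem Tm.subst_inl {k m : ℕ} (σ : Fin k → Tm m) : (inl : Tm k).subst σ = inl := by
  simp [inl, subst]; exact ⟨rfl, rfl⟩

theorem Tm.subst_inr {k m : ℕ} (σ : Fin k → Tm m) : (inr : Tm k).subst σ = inr := by
  simp [inr, subst]; rfl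

theorem Pole.const_mem (h : Proc.mk t π ∈ P.carrier) :
    Proc.mk .const (.push t (.push u π)) ∈ P.carrier := by
  refine lam_mem (lam_mem ?_)
  convert h
  change ((t.rename _).subst _) = t
  simp [Tm.rename_closed]

theorem Pole.flip_mem (h : Proc.mk u (.push t π) ∈ P.carrier) :
    Proc.mk .flip (.push t (.push u π)) ∈ P.carrier := by
  refine lam_mem (lam_mem (app_mem ?_))
  convert h
  · rfl
  · change ((t.rename _).subst _) = t
    simp [Tm.rename_closed]

theorem Pole.pair_mem (h : Proc.mk v (.push t (.push u π)) ∈ P.carrier) :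
    Proc.mk .pair (.push t (.push u (.push v π))) ∈ P.carrier := by
  refine lam_mem (lam_mem (lam_mem (app_mem (app_mem ?_))))
  convert h
  · rfl
  · change ((((t.rename _).rename _).subst _).subst _) = t
    simp [Tm.rename_closed]
  · change ((u.rename _).subst _) = u
    simp [Tm.rename_closed]

theorem Pole.ident_mem (h : Proc.mk t π ∈ P.carrier) :
    Proc.mk .ident (.push t π) ∈ P.carrier :=
  lam_mem h

theorem Pole.inl_mem (h : Proc.mk u (.push t π) ∈ P.carrier) :
    Proc.mk .inl (.push t (.push u (.push v π))) ∈ P.carrier := by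
  refine lam_mem (lam_mem (lam_mem (app_mem ?_)))
  convert h
  · change ((u.rename _).subst _) = u
    simp [Tm.rename_closed]
  · change ((((t.rename _).rename _).subst _).subst _) = t
    simp [Tm.rename_closed]

theorem Pole.inr_mem (h : Proc.mk v (.push t π) ∈ P.carrier) :
    Proc.mk .inr (.push t (.push u (.push v π))) ∈ P.carrier := by
  refine lam_mem (lam_mem (lam_mem (app_mem ?_)))
  convert h
  · rfl
  · change ((((t.rename _).rename _).subst _).subst _) = t
    simp [Tm.rename_closed]

end Pole

/-! ### Falsity values of the defined connectives -/

@[simp] theorem SOEnv.cons_zero {Γ : List ℕ} {m : ℕ} (F : (Fin m → ℕ) → Set Stack)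
    (σ : SOEnv Γ) : σ.cons F m .zero = F := rfl

theorem Formula.falsity_renameSO (P : Pole) {Γ Δ : List ℕ} {k : ℕ} (A : Formula Γ k)
    (ξ : ∀ n : ℕ, SOVar Γ n → SOVar Δ n) (σ : SOEnv Δ) (ρ : Fin k → ℕ) :
    (A.renameSO ξ).falsity P σ ρ = A.falsity P (fun n X => σ n (ξ n X)) ρ := by
  induction A generalizing Δ with
  | all₂ n A ih =>
    simp only [renameSO, falsity, ih]
    congr 1
    funext F
    congr 1
    funext m X
    cases X <;> rfl
  | _ => simp_all [renameSO, falsity]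

@[simp] theorem Formula.falsity_weaken (P : Pole) {Γ : List ℕ} {k m : ℕ} (A : Formula Γ k)
    (F : (Fin m → ℕ) → Set Stack) (σ : SOEnv Γ) (ρ : Fin k → ℕ) :
    (A.weaken m).falsity P (σ.cons F) ρ = A.falsity P σ ρ :=
  A.falsity_renameSO P _ _ ρ

section Semantics

variable {P : Pole} {Γ : List ℕ} {k : ℕ} {A B : Formula Γ k} {σ : SOEnv Γ} {ρ : Fin k → ℕ}
  {t u : Tm 0} {π : Stack}

theorem Formula.and_intro (ht : t ∈ P.dual (A.falsity P σ ρ)) (hu : u ∈ P.dual (B.falsity P σ ρ)) :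
    .app (.app .pair t) u ∈ P.dual ((A.and B).falsity P σ ρ) := by
  rintro s hs
  simp only [Formula.and, falsity, Set.mem_iUnion, falsity_weaken] at hs
  obtain ⟨F, f, hf, π, hπ, rfl⟩ := hs
  exact Pole.app_mem (Pole.app_mem (Pole.pair_mem (hf _ ⟨t, ht, _, ⟨u, hu, π, hπ, rfl⟩, rfl⟩)))

/-- Taking the single stack `π` as the falsity value of `Z` reduces elimination to a condition on
that stack alone. `or_elim` uses the same choice. -/
theorem Formula.and_elim (ht : t ∈ P.dual ((A.and B).falsity P σ ρ))
    (hu : ∀ a ∈ P.dual (A.falsity P σ ρ), ∀ b ∈ P.dual (B.falsity P σ ρ),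
      Proc.mk u (.push a (.push b π)) ∈ P.carrier) :
    Proc.mk t (.push u π) ∈ P.carrier := by
  refine ht _ ?_
  simp only [Formula.and, falsity, Set.mem_iUnion, falsity_weaken]
  refine ⟨fun _ => {π}, u, ?_, π, rfl, rfl⟩
  rintro _ ⟨a, ha, _, ⟨b, hb, _, rfl, rfl⟩, rfl⟩
  exact hu a ha b hb

theorem Formula.or_inl (ht : t ∈ P.dual (A.falsity P σ ρ)) :
    .app .inl t ∈ P.dual ((A.or B).falsity P σ ρ) := by
  rintro s hs
  simp only [Formula.or, falsity, Set.mem_iUnion, falsity_weaken] at hs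
  obtain ⟨F, f, hf, _, ⟨g, -, π, hπ, rfl⟩, rfl⟩ := hs
  exact Pole.app_mem (Pole.inl_mem (hf _ ⟨t, ht, π, hπ, rfl⟩))

theorem Formula.or_inr (ht : t ∈ P.dual (B.falsity P σ ρ)) :
    .app .inr t ∈ P.dual ((A.or B).falsity P σ ρ) := by
  rintro s hs
  simp only [Formula.or, falsity, Set.mem_iUnion, falsity_weaken] at hs
  obtain ⟨F, f, -, _, ⟨g, hg, π, hπ, rfl⟩, rfl⟩ := hs
  exact Pole.app_mem (Pole.inr_mem (hg _ ⟨t, ht, π, hπ, rfl⟩))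

theorem Formula.or_elim (ht : t ∈ P.dual ((A.or B).falsity P σ ρ)) {f g : Tm 0}
    (hf : ∀ a ∈ P.dual (A.falsity P σ ρ), Proc.mk f (.push a π) ∈ P.carrier)
    (hg : ∀ b ∈ P.dual (B.falsity P σ ρ), Proc.mk g (.push b π) ∈ P.carrier) :
    Proc.mk t (.push f (.push g π)) ∈ P.carrier := by
  refine ht _ ?_
  simp only [Formula.or, falsity, Set.mem_iUnion, falsity_weaken]
  refine ⟨fun _ => {π}, f, ?_, _, ⟨g, ?_, π, rfl, rfl⟩, rfl⟩
  · rintro _ ⟨a, ha, _, rfl, rfl⟩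
    exact hf a ha
  · rintro _ ⟨a, ha, _, rfl, rfl⟩
    exact hg a ha

theorem Formula.pair_or_elim {f g : Tm 0}
    (hf : ∀ a ∈ P.dual (A.falsity P σ ρ), Proc.mk f (.push a π) ∈ P.carrier)
    (hg : ∀ b ∈ P.dual (B.falsity P σ ρ), Proc.mk g (.push b π) ∈ P.carrier) :
    ∀ t ∈ P.dual ((A.or B).falsity P σ ρ),
      Proc.mk (.app (.app .pair f) g) (.push t π) ∈ P.carrier :=
  fun _ ht => Pole.app_mem (Pole.app_mem (Pole.pair_mem (or_elim ht hf hg)))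

theorem Formula.eq_intro {a b : FOTerm k} (h : a.val ρ = b.val ρ) :
    .ident ∈ P.dual ((Formula.eq a b : Formula Γ k).falsity P σ ρ) := by
  rintro s hs
  simp only [Formula.eq, rel₁, falsity, Set.mem_iUnion] at hs
  obtain ⟨F, t, ht, π, hπ, rfl⟩ := hs
  refine Pole.ident_mem (ht _ ?_)
  convert hπ using 3 with j
  simp [h]

/-- A handler for an equation has work to do only when the equation is true; for a false one, any
term serves. -/
theorem Formula.flip_eq_elim {a b : FOTerm k}
    (h : a.val ρ = b.val ρ → Proc.mk t π ∈ P.carrier) :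
    ∀ w ∈ P.dual ((Formula.eq a b : Formula Γ k).falsity P σ ρ),
      Proc.mk (.app .flip t) (.push w π) ∈ P.carrier := by
  intro w hw
  refine Pole.app_mem (Pole.flip_mem (hw _ ?_))
  simp only [Formula.eq, rel₁, falsity, Set.mem_iUnion]
  -- `Z` has falsity value `{π}` at the value of `b` and is empty elsewhere, so every closed term
  -- realizes `Z(a)` when the two values differ.
  refine ⟨fun v => {s | v 0 = b.val ρ ∧ s = π}, t, ?_, π, ⟨rfl, rfl⟩, rfl⟩
  rintro _ ⟨hab, rfl⟩
  exact h hab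

end Semantics

theorem Formula.mem_falsity_allGimel {P : Pole} {Γ : List ℕ} {k : ℕ} {A : Formula Γ (k + 1)}
    {n : ℕ} {σ : SOEnv Γ} {ρ : Fin k → ℕ} {s : Stack} :
    s ∈ (A.allGimel n).falsity P σ ρ ↔ ∃ m < n, s ∈ A.falsity P σ (Fin.cons m ρ) := by
  simp [allGimel, falsity, FOTerm.min, FOTerm.succ, FOTerm.const, FOTerm.val]

theorem Formula.mem_falsity_closeGimel {P : Pole} {Γ : List ℕ} {k : ℕ} {A : Formula Γ k}
    {n : ℕ} {σ : SOEnv Γ} {s : Stack} :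
    s ∈ (A.closeGimel n).falsity P σ Fin.elim0 ↔
      ∃ ρ : Fin k → ℕ, (∀ i, ρ i < n) ∧ s ∈ A.falsity P σ ρ := by
  induction k with
  | zero =>
    refine ⟨fun h => ⟨_, fun i => i.elim0, h⟩, ?_⟩
    rintro ⟨ρ, -, h⟩
    rwa [Subsingleton.elim ρ Fin.elim0] at h
  | succ k ih =>
    simp only [closeGimel, ih, mem_falsity_allGimel]
    constructor
    · rintro ⟨ρ, hρ, m, hm, hs⟩
      exact ⟨_, Fin.cases hm hρ, hs⟩
    · rintro ⟨ρ, hρ, hs⟩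
      exact ⟨Fin.tail ρ, fun i => hρ _, ρ 0, hρ 0, by rwa [Fin.cons_self_tail]⟩

theorem gimelLt_two : gimelLt 2 = Formula.closeGimel 2 (k := 2)
    (.or (.eq (.var 0) (.var 1)) (.eq (.var 1) (.var 0))) := rfl

/-- The order of the disjuncts, nested to the left, dictates the chains of injections in the
realizers and the nesting of handlers in `boolCases`. -/
theorem gimelLt_three : gimelLt 3 = Formula.closeGimel 2 (k := 3)
    (.or (.or (.or (.or (.or (.eq (.var 0) (.var 1)) (.eq (.var 0) (.var 2)))
      (.eq (.var 1) (.var 0))) (.eq (.var 1) (.var 2))) (.eq (.var 2) (.var 0)))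
      (.eq (.var 2) (.var 1))) := rfl

/-! ### `ℷ2` has at least two elements -/

/-- A realizer of `|ℷ2| ≥ 2`. -/
def Tm.gimelGeTwo : Tm 0 :=
  .lam (.app (.app (.var 0) (.app .flip .ident)) (.app .flip .ident))

theorem realizes_gimelGe_two (P : Pole) : Realizes P .gimelGeTwo (gimelGe 2) := by
  rintro _ ⟨t, ht, π, -, rfl⟩
  refine Pole.lam_mem (Pole.app_mem (Pole.app_mem ?_))
  simp only [Tm.subst, Tm.subst_flip, Tm.subst_ident]
  -- At the instance `(0, 1)` both equations are false, so the handlers are arbitrary.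
  refine Formula.or_elim (P := P) (Γ := []) (k := 2) (A := .eq (.var 0) (.var 1))
    (B := .eq (.var 1) (.var 0)) (σ := .nil) (ρ := ![0, 1]) (fun s hs => ht s ?_)
    (Formula.flip_eq_elim ?_) (Formula.flip_eq_elim ?_)
  · rw [gimelLt_two, Formula.mem_falsity_closeGimel]
    exact ⟨![0, 1], by decide, hs⟩
  · simp [FOTerm.val]
  · simp [FOTerm.val]

/-! ### If every individual is an integer, `ℷ2` has at most two elements -/

/-- Recursion up to `b` starts from `g₀` and has the constant step `g₁`. Concentrating `Z` at `b`
leaves obligations only for the value that `b` actually takes. -/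
theorem allNat_cases {P : Pole} {v g₀ g₁ : Tm 0} {π : Stack} (hv : Realizes P v allNat) {b : ℕ}
    (hb : b < 2) (h₀ : b = 0 → Proc.mk g₀ π ∈ P.carrier) (h₁ : b = 1 → Proc.mk g₁ π ∈ P.carrier) :
    Proc.mk (.app (.app v (.app .const g₁)) g₀) π ∈ P.carrier := by
  refine Pole.app_mem (Pole.app_mem (hv _ ?_))
  simp only [allNat, Formula.nat, Formula.rel₁, Formula.falsity, Set.mem_iUnion]
  refine ⟨b, fun w => {s | w 0 = b ∧ s = π}, _, ?_, _, ⟨g₀, ?_, π, ⟨rfl, rfl⟩, rfl⟩, rfl⟩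
  · intro s hs
    simp only [Set.mem_iUnion] at hs
    obtain ⟨m, t, -, s, ⟨hm, rfl⟩, rfl⟩ := hs
    have hm : m + 1 = b := hm
    -- Only the step arriving at `b` matters. Since `b < 2`, it arrives at `1`, and the realizer of
    -- `Z(m)` is thrown away.
    exact Pole.app_mem (Pole.const_mem (h₁ (by omega)))
  · rintro s ⟨hs, rfl⟩
    exact h₀ (Eq.symm hs)

/-- Case distinction by `v`, a realizer of `∀ x, nat(x)`: `g₀` if the individual is `0`, and `g₁`
if it is `1`. -/
def Tm.cases {k : ℕ} (v g₀ g₁ : Tm k) : Tm k := .app (.app v (.app .const g₁)) g₀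

/-- Realizes the disjunctions of `|ℷ2| < 3` whose equation `x₁ = x₂` is true. -/
def Tm.disjunctA {k : ℕ} : Tm k := .app .inl (.app .inl (.app .inl (.app .inl (.app .inl .ident))))

/-- Realizes the disjunctions of `|ℷ2| < 3` whose equation `x₁ = x₃` is true. -/
def Tm.disjunctB {k : ℕ} : Tm k := .app .inl (.app .inl (.app .inl (.app .inl (.app .inr .ident))))

/-- Realizes the disjunctions of `|ℷ2| < 3` whose equation `x₂ = x₃` is true. -/
def Tm.disjunctC {k : ℕ} : Tm k := .app .inl (.app .inl (.app .inr .ident))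

/-- A realizer of `(∀ x, nat(x)) → |ℷ2| < 3`. -/
def Tm.gimelLtThree : Tm 0 :=
  .lam (cases (.var 0)
    (cases (.var 0) disjunctA (cases (.var 0) disjunctB disjunctC))
    (cases (.var 0) (cases (.var 0) disjunctC disjunctB) disjunctA))

theorem realizes_gimelLt_three (P : Pole) : Realizes P .gimelLtThree (.imp allNat (gimelLt 3)) := by
  rintro _ ⟨v, hv, π, hπ, rfl⟩
  rw [gimelLt_three, Formula.mem_falsity_closeGimel] at hπ
  obtain ⟨ρ, hρ, hπ⟩ := hπ
  have hA : ρ 0 = ρ 1 → Proc.mk .disjunctA π ∈ P.carrier := fun h =>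
    Formula.or_inl (Formula.or_inl (Formula.or_inl (Formula.or_inl (Formula.or_inl
      (Formula.eq_intro (by exact h)))))) π hπ
  have hB : ρ 0 = ρ 2 → Proc.mk .disjunctB π ∈ P.carrier := fun h =>
    Formula.or_inl (Formula.or_inl (Formula.or_inl (Formula.or_inl (Formula.or_inr
      (Formula.eq_intro (by exact h)))))) π hπ
  have hC : ρ 1 = ρ 2 → Proc.mk .disjunctC π ∈ P.carrier := fun h =>
    Formula.or_inl (Formula.or_inl (Formula.or_inr (Formula.eq_intro (by exact h)))) π hπ
  refine Pole.lam_mem ?_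
  simp only [Tm.cases, Tm.disjunctA, Tm.disjunctB, Tm.disjunctC, Tm.subst, Tm.subst_const,
    Tm.subst_inl, Tm.subst_inr, Tm.subst_ident] at hA hB hC ⊢
  -- Pigeonhole: the third Boolean is tested only when the first two differ, and it then equals one
  -- of them.
  refine allNat_cases hv (hρ 0) (fun h0 => ?_) (fun h0 => ?_)
  · refine allNat_cases hv (hρ 1) (fun h1 => hA (h0.trans h1.symm)) fun h1 => ?_
    exact allNat_cases hv (hρ 2) (fun h2 => hB (h0.trans h2.symm)) fun h2 => hC (h1.trans h2.symm)
  · refine allNat_cases hv (hρ 1) (fun h1 => ?_) fun h1 => hA (h0.trans h1.symm)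
    exact allNat_cases hv (hρ 2) (fun h2 => hC (h1.trans h2.symm)) fun h2 => hB (h0.trans h2.symm)

/-! ### If `ℷ2` has at most two elements, every individual is an integer -/

/-- Case distinction by `u`, a realizer of `|ℷ2| < 3`, on the Boolean `b`, by means of the instance
`b, 0, 1`: `g₀` if `b` is `0`, and `g₁` if it is `1`. -/
def Tm.boolCases {k : ℕ} (u g₀ g₁ : Tm k) : Tm k :=
  .app (.app u (.app (.app .pair (.app (.app .pair (.app (.app .pair (.app (.app .pair
    (.app .flip g₀)) (.app .flip g₁))) (.app .flip g₀))) (.app .flip g₁))) (.app .flip g₁)))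
    (.app .flip g₁)

theorem Tm.subst_boolCases {k m : ℕ} (u g₀ g₁ : Tm k) (σ : Fin k → Tm m) :
    (boolCases u g₀ g₁).subst σ = boolCases (u.subst σ) (g₀.subst σ) (g₁.subst σ) := by
  simp only [boolCases, subst, subst_pair, subst_flip]

/-- The term does not mention `b`: the value of `b` is picked in the proof, so the same term can
stand for `g₀` against one stack and for `g₁` against another. -/
theorem boolCases_mem {P : Pole} {u g₀ g₁ : Tm 0} {π : Stack} (hu : Realizes P u (gimelLt 3))
    {b : ℕ} (hb : b < 2) (h₀ : b = 0 → Proc.mk g₀ π ∈ P.carrier)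
    (h₁ : b = 1 → Proc.mk g₁ π ∈ P.carrier) :
    Proc.mk (.boolCases u g₀ g₁) π ∈ P.carrier := by
  refine Pole.app_mem (Pole.app_mem ?_)
  -- At `(b, 0, 1)` four equations say `b = 0` or `b = 1`, up to symmetry. The other two, `0 = 1`
  -- and `1 = 0`, are false, and `g₁` is a mere filler there.
  refine Formula.or_elim (P := P) (Γ := []) (k := 3)
    (A := .or (.or (.or (.or (.eq (.var 0) (.var 1)) (.eq (.var 0) (.var 2)))
      (.eq (.var 1) (.var 0))) (.eq (.var 1) (.var 2))) (.eq (.var 2) (.var 0)))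
    (B := .eq (.var 2) (.var 1)) (σ := .nil) (ρ := ![b, 0, 1]) (fun s hs => hu s ?_)
    (Formula.pair_or_elim (Formula.pair_or_elim (Formula.pair_or_elim (Formula.pair_or_elim
      (Formula.flip_eq_elim h₀) (Formula.flip_eq_elim h₁))
      (Formula.flip_eq_elim fun h => h₀ h.symm)) (Formula.flip_eq_elim ?_))
      (Formula.flip_eq_elim fun h => h₁ h.symm)) (Formula.flip_eq_elim ?_)
  · rw [gimelLt_three, Formula.mem_falsity_closeGimel]
    exact ⟨![b, 0, 1], by intro i; fin_cases i <;> simp [hb], hs⟩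
  · simp [FOTerm.val]
  · simp [FOTerm.val]

/-- The term `λ w, if b then z else s (w w)`, with variables `z`, `s`, `u` in this order. -/
def Tm.recursor : Tm 3 :=
  .lam (boolCases (.var 3) (.app (.var 2) (.app (.var 0) (.var 0))) (.var 1))

/-- A realizer of `|ℷ2| < 3 → ∀ x, nat(x)`. -/
def Tm.allNat : Tm 0 := .lam (.lam (.lam (.app .recursor .recursor)))

theorem realizes_allNat (P : Pole) : Realizes P .allNat (.imp (gimelLt 3) allNat) := by
  rintro _ ⟨u, hu, π, hπ, rfl⟩
  simp only [ClassicalRealizability.allNat, Formula.nat, Formula.rel₁, Formula.falsity,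
    Set.mem_iUnion] at hπ
  obtain ⟨x, F, s, hs, _, ⟨z, hz, π, hπ, rfl⟩, rfl⟩ := hπ
  have hF : ∀ n, F ![n] = F fun _ => n := fun n => congrArg F (funext fun i => by simp)
  replace hz : ∀ π ∈ F ![0], Proc.mk z π ∈ P.carrier := by
    intro π hπ
    refine hz π ?_
    convert hπ
    simp [hF, FOTerm.const, FOTerm.val]
  replace hs : ∀ (m : ℕ) (t : Tm 0), (∀ π ∈ F ![m], Proc.mk t π ∈ P.carrier) →
      ∀ π ∈ F ![m + 1], Proc.mk s (.push t π) ∈ P.carrier := by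
    intro m t ht π hπ
    refine hs _ (Set.mem_iUnion.2 ⟨m, t, fun π' hπ' => ht π' ?_, π, ?_, rfl⟩)
    · convert hπ'
      simp [hF, FOTerm.val]
    · convert hπ
      simp [hF, FOTerm.succ, FOTerm.val]
  replace hπ : π ∈ F ![x] := by
    convert hπ
    simp [hF, FOTerm.val]
  -- This is `recursor` once `u`, `s` and `z` have been substituted.
  set W : Tm 0 := .lam (.boolCases u.lift (.app s.lift (.app (.var 0) (.var 0))) z.lift) with hW
  have key : ∀ (x : ℕ), ∀ π ∈ F ![x], Proc.mk (.app W W) π ∈ P.carrier := by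
    intro x
    induction x with
    | zero =>
      intro π hπ
      refine Pole.app_mem (Pole.lam_mem ?_)
      simp only [Tm.subst_boolCases, Tm.subst_lift, Tm.lift_zero]
      -- The Boolean stands for the truth value of `x = 0`: `1` selects `z` here, and `0` selects `s
      -- (W W)` at successors.
      exact boolCases_mem hu (b := 1) (by decide) (by simp) fun _ => hz π hπ
    | succ x ih =>
      intro π hπ
      refine Pole.app_mem (Pole.lam_mem ?_)
      simp only [Tm.subst_boolCases, Tm.subst_lift, Tm.lift_zero, Tm.subst]
      exact boolCases_mem hu (b := 0) (by decide)
        (fun _ => Pole.app_mem (hs x _ ih π hπ)) (by simp)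
  refine Pole.lam_mem (Pole.lam_mem (Pole.lam_mem ?_))
  convert key x π hπ
  simp only [Tm.recursor, Tm.subst, Tm.subst_boolCases, hW]
  -- What remains is syntactic: the closed terms `u`, `s`, `z` were renamed under binders and passed
  -- through the later substitutions, neither of which alters them.
  refine congrArg (fun B : Tm 1 => Tm.app (.lam B) (.lam B))
    (congr (congr (congrArg Tm.boolCases ?_) (congrArg₂ Tm.app ?_ rfl)) ?_)
  · change (((((u.rename _).rename _).rename _).subst _).subst _) = u.lift
    simp [Tm.rename_closed]
  · change (((s.rename _).rename _).subst _) = s.lift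
    simp [Tm.rename_closed]
  · exact Tm.rename_closed z _

/-! ### The equivalence -/

/-- A realizer of `|ℷ2| = 2 → ∀ x, nat(x)`. -/
def Tm.gimelEqToAllNat : Tm 0 := .app .flip (.app .const .allNat)

theorem realizes_gimelEqToAllNat (P : Pole) :
    Realizes P .gimelEqToAllNat (.imp (gimelEq 2) allNat) := by
  rintro _ ⟨t, ht, π, hπ, rfl⟩
  -- The component `|ℷ2| ≥ 2` carries no information and is dropped.
  refine Pole.app_mem (Pole.flip_mem (Formula.and_elim ht fun a _ b hb => ?_))
  exact Pole.app_mem (Pole.const_mem (realizes_allNat P _ ⟨b, hb, π, hπ, rfl⟩))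

/-- A realizer of `(∀ x, nat(x)) → |ℷ2| = 2`. -/
def Tm.allNatToGimelEq : Tm 0 :=
  .lam (.app (.app .pair (lift .gimelGeTwo)) (.app (lift .gimelLtThree) (.var 0)))

theorem realizes_allNatToGimelEq (P : Pole) :
    Realizes P .allNatToGimelEq (.imp allNat (gimelEq 2)) := by
  rintro _ ⟨v, hv, π, hπ, rfl⟩
  refine Pole.lam_mem ?_
  simp only [Tm.subst, Tm.subst_pair, Tm.subst_lift, Tm.lift_zero]
  exact Formula.and_intro (realizes_gimelGe_two P)
    (fun s hs => Pole.app_mem (realizes_gimelLt_three P _ ⟨v, hv, s, hs, rfl⟩)) π hπ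

end ClassicalRealizability

theorem mainTheorem10 :
    ClassicalRealizability.UniversallyEquivalent
      (ClassicalRealizability.gimelEq 2) ClassicalRealizability.allNat := by
  open ClassicalRealizability in
  refine ⟨.app (.app .pair .gimelEqToAllNat) .allNatToGimelEq, ?_, fun P => ?_⟩
  · simp [Tm.ProofLike, Tm.pair, Tm.gimelEqToAllNat, Tm.allNatToGimelEq, Tm.flip, Tm.const,
      Tm.allNat, Tm.recursor, Tm.boolCases, Tm.gimelGeTwo, Tm.gimelLtThree, Tm.cases,
      Tm.disjunctA, Tm.disjunctB, Tm.disjunctC, Tm.inl, Tm.inr, Tm.ident, Tm.lift, Tm.rename]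
  · exact Formula.and_intro (realizes_gimelEqToAllNat P) (realizes_allNatToGimelEq P)
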